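/- Conventions. A matrix grammar is a tuple $G=(N,\Sigma,M,S)$ with finite disjoint sets $N$ of nonterminals and $\Sigma$ of terminals, a start symbol $S\in N$, and a finite set $M$ of matrix rules, each a finite sequence $m=(A_1\to w_1,\dots,A_h\to w_h)$ of context-free productions with $A_j\in N$ and $w_j\in(N\cup\Sigma)^*$. One writes $x\Rightarrow_m y$ if applying the productions of $m$ one after the other, in the given order, leads from $x$ to $y$. A derivation of $w\in\Sigma^*$ is a sequence $S=x_0\Rightarrow_{m_1}x_1\Rightarrow_{m_2}\cdots\Rightarrow_{m_s}x_s=w$ with $m_i\in M$; two derivations are equal if they consist of the same matrix rules and the same strings. A sentential form is a string reachable in this way from $S$, and $L(G)$ is the set of the sentential forms in $\Sigma^*$. $G$ is unambiguous if every word of $L(G)$ has exactly one derivation. $G$ has finite index if there is a $k$ such that every word of $L(G)$ has a derivation in which each of the strings $x_0,\dots,x_s$ has at most $k$ occurrences of nonterminals. $G$ is in normal form if (1) in each sentential form every nonterminal occurs at most once, and (2) whenever a matrix rule $(A_1\to w_1,\dots,A_h\to w_h)$ is applied to a sentential form $x$, all $A_1,\dots,A_h$ occur in $x$ and each production $A_j\to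 w_j$ replaces an occurrence of $A_j$ in $x$ itself (not one introduced by an earlier production of the same matrix rule). Series have coefficients in the complete semiring $\mathbb N_0\cup\{+\infty\}$. Let $c\colon\Sigma^*\to\Sigma^{\oplus}$ be the projection onto the free commutative monoid on $\Sigma$. The characteristic series $c(\underline L)$ of a language $L\subseteq\Sigma^*$ in commutative variables has as its coefficient at $v\in\Sigma^\oplus$ the number of words $w\in L$ with $c(w)=v$. The characteristic series $c(\underline G)$ of $G$ in commutative variables has as its coefficient at $v$ the (possibly infinite) sum, over all words $w\in\Sigma^*$ with $c(w)=v$, of the number of derivations of $w$ in $G$. A series on $\Sigma^\oplus$ is rational if it belongs to the smallest family that contains all polynomials (series with finite support) and is closed under sum, (Cauchy) product and star $f\mapsto f^*=\sum_{n\ge 0}f^n$. Proposition. (a) If $L$ is the language generated by an unambiguous matrix grammar of finite index, then the characteristic series of $L$ in commutative variables is rational. (b) If $G$ is a matrix grammar of finite index in normal form, then the characteristic series of $G$ in commutative variables is rational. -/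

import Mathlib

/-- The sum of an arbitrary family in the complete semiring `ℕ ∪ {∞}`:
the supremum of its finite partial sums. -/
noncomputable def completeSum {ι : Type*} (f : ι → ℕ∞) : ℕ∞ :=
  ⨆ F : Finset ι, ∑ i ∈ F, f i

/-- The star `f* = 1 + f + f² + f³ + ⋯` of a series in commuting variables with
coefficients in `ℕ ∪ {∞}`. -/
noncomputable def seriesStar {T : Type*} (f : MvPowerSeries T ℕ∞) : MvPowerSeries T ℕ∞ :=
  fun v => completeSum fun n : ℕ => MvPowerSeries.coeff v (f ^ n)

/-- Rational series on the free commutative monoid over `T` with coefficients in `ℕ ∪ {∞}`: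
the smallest family containing all monomials (hence all polynomials) and closed under
sum, product and star. -/
inductive IsRationalSeries {T : Type*} : MvPowerSeries T ℕ∞ → Prop
  | monomial (v : T →₀ ℕ) (c : ℕ∞) : IsRationalSeries (MvPowerSeries.monomial v c)
  | add {f g : MvPowerSeries T ℕ∞} :
      IsRationalSeries f → IsRationalSeries g → IsRationalSeries (f + g)
  | mul {f g : MvPowerSeries T ℕ∞} :
      IsRationalSeries f → IsRationalSeries g → IsRationalSeries (f * g)
  | star {f : MvPowerSeries T ℕ∞} :
      IsRationalSeries f → IsRationalSeries (seriesStar f)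

/-- The natural projection of a word to the free commutative monoid, i.e. its Parikh vector. -/
noncomputable def parikh {T : Type*} (w : List T) : T →₀ ℕ :=
  (w.map fun a => Finsupp.single a 1).sum

/-- The image in commuting variables of a series in non-commuting variables. -/
noncomputable def commImage {T : Type*} (s : List T → ℕ∞) : MvPowerSeries T ℕ∞ :=
  fun v => completeSum fun w : {w : List T // parikh w = v} => s w.1

open Classical in
/-- The characteristic series of a language in non-commuting variables. -/
noncomputable def languageSeries {T : Type*} (L : Language T) : List T → ℕ∞ :=
  fun w => if w ∈ L then 1 else 0

/-- A matrix rule: a finite sequence of context-free productions. -/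
abbrev MatrixRule (T N : Type*) := List (ContextFreeRule T N)

/-- Context-free matrix grammars with terminals `T` and nonterminals `N`. -/
structure MatrixGrammar (T N : Type*) where
  /-- The start symbol. -/
  initial : N
  /-- The finite set of matrix rules. -/
  rules : Finset (MatrixRule T N)

/-- `MatrixStep m x y`: the productions of `m`, applied one after the other, lead from `x` to `y`. -/
inductive MatrixStep {T N : Type*} :
    MatrixRule T N → List (Symbol T N) → List (Symbol T N) → Prop
  | nil (x : List (Symbol T N)) : MatrixStep [] x x
  | cons {p : ContextFreeRule T N} {m : MatrixRule T N} {x y z : List (Symbol T N)} :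
      p.Rewrites x y → MatrixStep m y z → MatrixStep (p :: m) x z

/-- The word of nonterminal occurrences of a string (all terminals are deleted). -/
def nonterminalWord {T N : Type*} (x : List (Symbol T N)) : List N :=
  x.filterMap fun
    | Symbol.terminal _ => none
    | Symbol.nonterminal A => some A

/-- One production `p` rewriting one occurrence of its left-hand side in a string whose occurrences
carry marks: the rewritten occurrence carries the mark `b`, and every occurrence that
the production introduces gets the mark `false`. -/
def MarkedRewrites {T N : Type*} (p : ContextFreeRule T N) (b : Bool)
    (x y : List (Symbol T N × Bool)) : Prop :=
  ∃ u v : List (Symbol T N × Bool),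
    x = u ++ [(Symbol.nonterminal p.input, b)] ++ v ∧
    y = u ++ p.output.map (fun s => (s, false)) ++ v

/-- `MarkedStep m x bs y`: the productions of `m` lead successively from `x` to `y`, and
`bs` lists the marks of the successively rewritten occurrences. -/
inductive MarkedStep {T N : Type*} :
    MatrixRule T N → List (Symbol T N × Bool) → List Bool → List (Symbol T N × Bool) → Prop
  | nil (x : List (Symbol T N × Bool)) : MarkedStep [] x [] x
  | cons {p : ContextFreeRule T N} {m : MatrixRule T N} {b : Bool} {bs : List Bool}
      {x y z : List (Symbol T N × Bool)} :
      MarkedRewrites p b x y → MarkedStep m y bs z → MarkedStep (p :: m) x (b :: bs) z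

namespace MatrixGrammar

/-- `G.IsDerivation x₀ [(m₁, x₁), …, (mₛ, xₛ)] y`: one has `x₀ ⇒ x₁ ⇒ ⋯ ⇒ xₛ = y`, where the
`i`-th step applies the matrix rule `mᵢ` of `G`. -/
inductive IsDerivation {T N : Type*} (G : MatrixGrammar T N) :
    List (Symbol T N) → List (MatrixRule T N × List (Symbol T N)) → List (Symbol T N) → Prop
  | nil (x : List (Symbol T N)) : IsDerivation G x [] x
  | cons {m : MatrixRule T N} {x y z : List (Symbol T N)}
      {d : List (MatrixRule T N × List (Symbol T N))} :
      m ∈ G.rules → MatrixStep m x y → IsDerivation G y d z → IsDerivation G x ((m, y) :: d) z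

/-- The set of sentential forms. -/
def sententialForms {T N : Type*} (G : MatrixGrammar T N) : Set (List (Symbol T N)) :=
  {x | ∃ d, G.IsDerivation [Symbol.nonterminal G.initial] d x}

/-- The language generated by `G`. -/
def language {T N : Type*} (G : MatrixGrammar T N) : Language T :=
  {w : List T | w.map Symbol.terminal ∈ G.sententialForms}

/-- The derivations of the terminal word `w` in `G`. -/
def derivations {T N : Type*} (G : MatrixGrammar T N) (w : List T) :
    Set (List (MatrixRule T N × List (Symbol T N))) :=
  {d | G.IsDerivation [Symbol.nonterminal G.initial] d (w.map Symbol.terminal)}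

/-- `G` is unambiguous: every word of the language has exactly one derivation. -/
def Unambiguous {T N : Type*} (G : MatrixGrammar T N) : Prop :=
  ∀ w ∈ G.language, ∃! d, d ∈ G.derivations w

/-- The index of a derivation starting from `x`: the largest number of nonterminal occurrences
in one of its strings. -/
def derivationIndex {T N : Type*} (x : List (Symbol T N))
    (d : List (MatrixRule T N × List (Symbol T N))) : ℕ :=
  d.foldr (fun s k => max (nonterminalWord s.2).length k) (nonterminalWord x).length

/-- The index of a word generated by `G`: the minimal index of its derivations. -/
noncomputable def wordIndex {T N : Type*} (G : MatrixGrammar T N) (w : List T) : ℕ :=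
  sInf (derivationIndex [Symbol.nonterminal G.initial] '' G.derivations w)

/-- `G` has finite index: the indices of the words of its language are bounded. -/
def HasFiniteIndex {T N : Type*} (G : MatrixGrammar T N) : Prop :=
  ∃ k : ℕ, ∀ w ∈ G.language, G.wordIndex w ≤ k

/-- The normal form: (1) in every sentential form the nonterminal occurrences are pairwise distinct;
(2) whenever a matrix rule `(A₁ → w₁, …, Aₕ → wₕ)` is applied to a sentential form `x`, all of
`A₁, …, Aₕ` occur in `x` and each `Aⱼ → wⱼ` replaces an occurrence of `Aⱼ` in `x` itself (not an
occurrence introduced by an earlier production of the same matrix rule). -/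
structure NormalForm {T N : Type*} (G : MatrixGrammar T N) : Prop where
  distinct : ∀ x ∈ G.sententialForms, (nonterminalWord x).Nodup
  replaces : ∀ x ∈ G.sententialForms, ∀ m ∈ G.rules, ∀ bs y,
    MarkedStep m (x.map fun s => (s, true)) bs y →
      (∀ p ∈ m, Symbol.nonterminal p.input ∈ x) ∧ ∀ b ∈ bs, b = true

/-- The characteristic series of `G` in non-commuting variables: the coefficient of a word is
the (possibly infinite) number of its derivations. -/
noncomputable def series {T N : Type*} (G : MatrixGrammar T N) : List T → ℕ∞ :=
  fun w => (G.derivations w).encard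

end MatrixGrammar

/-! Under either hypothesis the relevant derivations have index at most some fixed `k`, so it
suffices that the series counting derivations of index at most `k` from a given string is rational
in commuting variables. Such a series solves a linear system with one equation per string: a
derivation is empty or consists of a first step followed by a derivation from its result
(`countSeries_add_one`).

The system must be made finite. In commuting variables, terminals already produced only contribute a
monomial factor, so one would like to keep only the word of nonterminals. This loses information:
derivations record strings, and whether two ways of applying a matrix rule to `x` give the same
string depends on the terminal blocks of `x`. If two substitutions into `x` are read in parallel,
one is ahead of the other by a string of bounded length, and a block `w` turns the delay `p` into
`r` when `p ++ w = w ++ r`. The relation formed by these pairs is all that matters about `w`. The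
nonterminals with these relations form the `profile`; it decides all coincidences
(`substNonterminals_eq_of_profile_eq`) and determines the profiles of the successors
(`profile_substNonterminals`), and only finitely many profiles occur at index at most `k`
(`finite_range_profile`).

Hence strings of equal profile have matching successors (`sum_successors_eq`), and the system
descends to profiles. Its least prefixed point is rational by elimination of unknowns
(`exists_rational_least_prefixed`), and it is the counting series. -/

open Finset in
/-- The complete sum of a sequence is the supremum of its initial partial sums. -/
theorem completeSum_eq_iSup_range (f : ℕ → ℕ∞) :
    completeSum f = ⨆ n, ∑ i ∈ range n, f i := by
  refine le_antisymm (iSup_le fun F => ?_) (iSup_le fun n => le_iSup (fun F => ∑ i ∈ F, f i) _)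
  obtain ⟨n, hn⟩ := F.exists_nat_subset_range
  exact (sum_le_sum_of_subset hn).trans (le_iSup (fun n => ∑ i ∈ range n, f i) n)

/-- The complete sum of a finite family is its sum. -/
theorem completeSum_eq_sum {ι : Type*} [Fintype ι] (f : ι → ℕ∞) :
    completeSum f = ∑ i, f i :=
  le_antisymm (iSup_le fun F => Finset.sum_le_sum_of_subset F.subset_univ)
    (le_iSup (fun F => ∑ i ∈ F, f i) Finset.univ)

/-! ### Least prefixed points of linear systems of series -/

section Order

variable {T : Type*}

/-- The coefficientwise order on series. -/
instance seriesPartialOrder : PartialOrder (MvPowerSeries T ℕ∞) :=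
  inferInstanceAs (PartialOrder ((T →₀ ℕ) → ℕ∞))

theorem series_le_def {f g : MvPowerSeries T ℕ∞} :
    f ≤ g ↔ ∀ v, MvPowerSeries.coeff v f ≤ MvPowerSeries.coeff v g := Iff.rfl

instance seriesIsOrderedRing : IsOrderedRing (MvPowerSeries T ℕ∞) where
  add_le_add_left f g h k := series_le_def.2 fun v => by
    simpa using add_le_add_left (series_le_def.1 h v) _
  zero_le_one := series_le_def.2 fun v => by simp
  mul_le_mul_of_nonneg_left f _ g h hgh := series_le_def.2 fun v => by
    classical
    simp only [MvPowerSeries.coeff_mul]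
    exact Finset.sum_le_sum fun p _ => by gcongr; exact series_le_def.1 hgh _
  mul_le_mul_of_nonneg_right f _ g h hgh := series_le_def.2 fun v => by
    classical
    simp only [MvPowerSeries.coeff_mul]
    exact Finset.sum_le_sum fun p _ => by gcongr; exact series_le_def.1 hgh _

instance seriesCanonicallyOrderedAdd : CanonicallyOrderedAdd (MvPowerSeries T ℕ∞) where
  exists_add_of_le {f g} h := by
    choose k hk using fun v => exists_add_of_le (series_le_def.1 h v)
    exact ⟨k, MvPowerSeries.ext hk⟩
  le_add_self f g := series_le_def.2 fun v => by simp
  le_self_add f g := series_le_def.2 fun v => by simp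

/-- A coefficient of a product is a finite sum, and in `ℕ∞` finite sums and products commute with
suprema of increasing sequences. No condition on the constant term of `a` is needed, since infinite
coefficients are allowed. -/
theorem coeff_seriesStar_mul (a c : MvPowerSeries T ℕ∞) (v : T →₀ ℕ) :
    MvPowerSeries.coeff v (seriesStar a * c) =
      ⨆ n, MvPowerSeries.coeff v ((∑ i ∈ Finset.range n, a ^ i) * c) := by
  classical
  have h (u : T →₀ ℕ) : MvPowerSeries.coeff u (seriesStar a) =
      ⨆ n, MvPowerSeries.coeff u (∑ i ∈ Finset.range n, a ^ i) := by
    simp only [map_sum]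
    exact completeSum_eq_iSup_range _
  simp only [MvPowerSeries.coeff_mul, h, ENat.iSup_mul]
  refine ENat.sum_iSup_of_monotone fun p m n hmn => ?_
  simp only [map_sum]
  gcongr

/-- One half of Arden's lemma: iterating the inequality puts every partial sum of the star,
multiplied by `c`, below `x`. With `mul_seriesStar_mul_add_le` it makes `seriesStar a * c` the least
prefixed point of `x ↦ a * x + c`. -/
theorem seriesStar_mul_le {a c x : MvPowerSeries T ℕ∞} (h : a * x + c ≤ x) :
    seriesStar a * c ≤ x := by
  have key (n : ℕ) : (∑ i ∈ Finset.range n, a ^ i) * c ≤ x := by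
    induction n with
    | zero => simp
    | succ n ih =>
      rw [Finset.sum_range_succ', pow_zero, add_mul, one_mul]
      refine le_trans (add_le_add_left ?_ c) h
      simp only [pow_succ']
      rw [← Finset.mul_sum, mul_assoc]
      gcongr
  refine series_le_def.2 fun v => ?_
  rw [coeff_seriesStar_mul]
  exact iSup_le fun n => series_le_def.1 (key n) v

theorem mul_seriesStar_mul_add_le (a c : MvPowerSeries T ℕ∞) :
    a * (seriesStar a * c) + c ≤ seriesStar a * c := by
  refine series_le_def.2 fun v => ?_
  have h : a * (seriesStar a * c) = seriesStar a * (a * c) := by ring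
  rw [h, map_add, coeff_seriesStar_mul, coeff_seriesStar_mul, ENat.iSup_add]
  refine iSup_le fun n => le_iSup_of_le (n + 1) (le_of_eq ?_)
  rw [← map_add, Finset.sum_range_succ', pow_zero]
  simp only [pow_succ]
  rw [← Finset.sum_mul]
  ring_nf

theorem IsRationalSeries.sum {ι : Type*} (s : Finset ι) {f : ι → MvPowerSeries T ℕ∞}
    (h : ∀ i ∈ s, IsRationalSeries (f i)) : IsRationalSeries (∑ i ∈ s, f i) := by
  classical
  induction s using Finset.induction_on with
  | empty => simpa using IsRationalSeries.monomial (0 : T →₀ ℕ) 0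
  | insert i s hi ih =>
    rw [Finset.sum_insert hi]
    exact (h i (by simp)).add (ih fun j hj => h j (by simp [hj]))

/-- A linear system over a finite index type with rational coefficients has a least prefixed
point, and its components are rational. -/
theorem exists_rational_least_prefixed (Q : Type*) [Finite Q] :
    ∀ [Fintype Q] (A : Q → Q → MvPowerSeries T ℕ∞) (b : Q → MvPowerSeries T ℕ∞),
      (∀ i j, IsRationalSeries (A i j)) → (∀ i, IsRationalSeries (b i)) →
      ∃ F : Q → MvPowerSeries T ℕ∞, (∀ i, IsRationalSeries (F i)) ∧
        (∀ i, ∑ j, A i j * F j + b i ≤ F i) ∧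
        ∀ G : Q → MvPowerSeries T ℕ∞, (∀ i, ∑ j, A i j * G j + b i ≤ G i) → F ≤ G := by
  induction Q using Finite.induction_empty_option with
  | of_equiv e ih =>
    intro _ A b hA hb
    let _ := Fintype.ofEquiv _ e.symm
    obtain ⟨F, hF, hle, hmin⟩ := ih (fun i j => A (e i) (e j)) (fun i => b (e i))
      (fun i j => hA _ _) (fun i => hb _)
    refine ⟨F ∘ e.symm, fun i => hF _, fun i => ?_, fun G hG i => ?_⟩
    · have := hle (e.symm i)
      rw [← e.sum_comp]
      simpa using this
    · have := hmin (G ∘ e) (fun i => by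
        have := hG (e i)
        rw [← e.sum_comp] at this
        simpa using this) (e.symm i)
      simpa using this
  | h_empty => exact fun A b _ _ => ⟨fun i => i.elim, fun i => i.elim, fun i => i.elim,
      fun G _ i => i.elim⟩
  -- Elimination of the unknown `none`: Arden's lemma expresses it through the other unknowns, and
  -- substituting this leaves a system over `Q`.
  | @h_option Q _ ih =>
    intro inst A b hA hb
    obtain rfl : inst = instFintypeOption := Subsingleton.elim _ _
    set s := seriesStar (A none none) with hs
    have hsr : IsRationalSeries s := (hA none none).star
    obtain ⟨F, hF, hle, hmin⟩ := ih
      (fun i j => A (some i) (some j) + A (some i) none * (s * A none (some j)))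
      (fun i => b (some i) + A (some i) none * (s * b none))
      (fun i j => (hA _ _).add ((hA _ _).mul (hsr.mul (hA _ _))))
      (fun i => (hb _).add ((hA _ _).mul (hsr.mul (hb _))))
    have reduce (G : Q → MvPowerSeries T ℕ∞) (i : Q) :
        ∑ j, (A (some i) (some j) + A (some i) none * (s * A none (some j))) * G j +
          (b (some i) + A (some i) none * (s * b none)) =
        A (some i) none * (s * (∑ j, A none (some j) * G j + b none)) +
          ∑ j, A (some i) (some j) * G j + b (some i) := by
      simp only [add_mul, Finset.sum_add_distrib, mul_add, Finset.mul_sum, mul_assoc]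
      ring
    let c : MvPowerSeries T ℕ∞ := ∑ j, A none (some j) * F j + b none
    refine ⟨fun i => i.elim (s * c) F, ?_, ?_, ?_⟩
    · rintro (_ | i)
      · exact hsr.mul ((IsRationalSeries.sum _ fun j _ => (hA _ _).mul (hF j)).add (hb _))
      · exact hF i
    · rintro (_ | i)
      · simpa [Fintype.sum_option, c, add_assoc] using mul_seriesStar_mul_add_le (A none none) c
      · have := hle i
        rw [reduce] at this
        simpa [Fintype.sum_option] using this
    -- Leastness in the equation of `none` bounds `G none` from below; by monotonicity the other
    -- components of `G` then form a prefixed point of the reduced system.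
    · intro G hG
      have hnone : s * (∑ j, A none (some j) * G (some j) + b none) ≤ G none := by
        refine seriesStar_mul_le ?_
        have := hG none
        rwa [Fintype.sum_option, add_assoc] at this
      have hsome : F ≤ fun i => G (some i) := hmin _ fun i => by
        rw [reduce]
        have := hG (some i)
        rw [Fintype.sum_option] at this
        refine le_trans ?_ this
        gcongr
      rintro (_ | i)
      · refine le_trans ?_ hnone
        change s * (∑ j, A none (some j) * F j + b none) ≤ _
        have (j : Q) : F j ≤ G (some j) := hsome j
        gcongr
        exact this _
      · exact hsome i

end Order

/-! ### Substitution for the nonterminal occurrences of a string -/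

section Substitution

variable {T N : Type*}

@[simp] theorem nonterminalWord_nil : nonterminalWord ([] : List (Symbol T N)) = [] := rfl

@[simp] theorem nonterminalWord_cons_terminal (a : T) (x : List (Symbol T N)) :
    nonterminalWord (Symbol.terminal a :: x) = nonterminalWord x := rfl

@[simp] theorem nonterminalWord_cons_nonterminal (A : N) (x : List (Symbol T N)) :
    nonterminalWord (Symbol.nonterminal A :: x) = A :: nonterminalWord x := rfl

theorem nonterminalWord_eq_nil_iff {x : List (Symbol T N)} :
    nonterminalWord x = [] ↔ ∃ w : List T, x = w.map Symbol.terminal := by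
  constructor
  · induction x with
    | nil => exact fun _ => ⟨[], rfl⟩
    | cons s x ih =>
      cases s with
      | terminal a =>
        intro h
        obtain ⟨w, rfl⟩ := ih h
        exact ⟨a :: w, rfl⟩
      | nonterminal A => simp
  · rintro ⟨w, rfl⟩
    induction w <;> simp_all

/-- Replace the successive nonterminal occurrences of a string by the given strings. -/
def substNonterminals : List (List (Symbol T N)) → List (Symbol T N) → List (Symbol T N)
  | _, [] => []
  | zs, Symbol.terminal a :: x => Symbol.terminal a :: substNonterminals zs x
  | [], Symbol.nonterminal _ :: x => substNonterminals [] x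
  | z :: zs, Symbol.nonterminal _ :: x => z ++ substNonterminals zs x

theorem substNonterminals_self (x : List (Symbol T N)) :
    substNonterminals ((nonterminalWord x).map fun A => [Symbol.nonterminal A]) x = x := by
  induction x with
  | nil => simp [substNonterminals]
  | cons s x ih => cases s <;> simp [substNonterminals, ih]

/-- A production rewrites one occurrence in one of the strings of a list. -/
inductive TupleRewrites (p : ContextFreeRule T N) :
    List (List (Symbol T N)) → List (List (Symbol T N)) → Prop
  | head {z z' : List (Symbol T N)} (zs : List (List (Symbol T N))) :
      p.Rewrites z z' → TupleRewrites p (z :: zs) (z' :: zs)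
  | tail (z : List (Symbol T N)) {zs zs' : List (List (Symbol T N))} :
      TupleRewrites p zs zs' → TupleRewrites p (z :: zs) (z :: zs')

/-- The productions of a matrix rule are applied one after the other to a list of strings. -/
inductive TupleStep :
    MatrixRule T N → List (List (Symbol T N)) → List (List (Symbol T N)) → Prop
  | nil (zs : List (List (Symbol T N))) : TupleStep [] zs zs
  | cons {p : ContextFreeRule T N} {m : MatrixRule T N} {xs ys zs : List (List (Symbol T N))} :
      TupleRewrites p xs ys → TupleStep m ys zs → TupleStep (p :: m) xs zs

theorem ContextFreeRule.Rewrites.length_le {p : ContextFreeRule T N} {x y : List (Symbol T N)}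
    (h : p.Rewrites x y) : y.length ≤ x.length + p.output.length := by
  obtain ⟨u, v, rfl, rfl⟩ := h.exists_parts
  simp only [List.length_append]
  omega

theorem ContextFreeRule.rewrites_append_iff {p : ContextFreeRule T N}
    {x y z : List (Symbol T N)} :
    p.Rewrites (x ++ y) z ↔
      (∃ x', p.Rewrites x x' ∧ z = x' ++ y) ∨ ∃ y', p.Rewrites y y' ∧ z = x ++ y' := by
  constructor
  · induction x generalizing z with
    | nil => exact fun h => Or.inr ⟨z, h, rfl⟩
    | cons s x ih =>
      intro h
      cases h with
      | head => exact Or.inl ⟨_, .head x, by simp⟩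
      | cons _ h =>
        rcases ih h with ⟨x', hx, rfl⟩ | ⟨y', hy, rfl⟩
        · exact Or.inl ⟨_, .cons s hx, rfl⟩
        · exact Or.inr ⟨y', hy, rfl⟩
  · rintro (⟨x', h, rfl⟩ | ⟨y', h, rfl⟩)
    · exact h.append_right y
    · exact h.append_left x

theorem TupleRewrites.length_eq {p : ContextFreeRule T N} {zs zs' : List (List (Symbol T N))}
    (h : TupleRewrites p zs zs') : zs'.length = zs.length := by
  induction h <;> simp_all

theorem TupleRewrites.length_flatten_le {p : ContextFreeRule T N}
    {zs zs' : List (List (Symbol T N))} (h : TupleRewrites p zs zs') :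
    zs'.flatten.length ≤ zs.flatten.length + p.output.length := by
  induction h with
  | head zs h =>
    have := h.length_le
    simp only [List.flatten_cons, List.length_append]
    omega
  | tail z _ ih =>
    simp only [List.flatten_cons, List.length_append]
    omega

theorem TupleStep.length_eq {m : MatrixRule T N} {zs zs' : List (List (Symbol T N))}
    (h : TupleStep m zs zs') : zs'.length = zs.length := by
  induction h with
  | nil => rfl
  | cons h _ ih => rw [ih, h.length_eq]

theorem TupleStep.length_flatten_le {m : MatrixRule T N} {zs zs' : List (List (Symbol T N))}
    (h : TupleStep m zs zs') :
    zs'.flatten.length ≤ zs.flatten.length + (m.map fun p => p.output.length).sum := by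
  induction h with
  | nil => simp
  | cons h _ ih =>
    have := h.length_flatten_le
    simp only [List.map_cons, List.sum_cons]
    omega

/-- Terminals of `x` are never rewritten, so the rewriting happens inside one of the substituted
strings. -/
theorem rewrites_substNonterminals_iff {p : ContextFreeRule T N} {x y : List (Symbol T N)}
    {zs : List (List (Symbol T N))} (hz : zs.length = (nonterminalWord x).length) :
    p.Rewrites (substNonterminals zs x) y ↔
      ∃ zs', TupleRewrites p zs zs' ∧ y = substNonterminals zs' x := by
  induction x generalizing y zs with
  | nil =>
    obtain rfl : zs = [] := by simpa using hz
    constructor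
    · intro h
      simpa [substNonterminals] using h.nonterminal_input_mem
    · rintro ⟨_, h, _⟩
      cases h
  | cons s x ih =>
    cases s with
    | terminal a =>
      simp only [substNonterminals]
      constructor
      · intro h
        cases h with
        | cons _ h =>
          obtain ⟨zs', h', rfl⟩ := (ih hz).1 h
          exact ⟨zs', h', rfl⟩
      · rintro ⟨zs', h, rfl⟩
        exact .cons _ ((ih hz).2 ⟨zs', h, rfl⟩)
    | nonterminal A =>
      obtain _ | ⟨z, zs⟩ := zs
      · simp at hz
      have hz' : zs.length = (nonterminalWord x).length := by simpa using hz
      simp only [substNonterminals, ContextFreeRule.rewrites_append_iff]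
      constructor
      · rintro (⟨z', h, rfl⟩ | ⟨y', h, rfl⟩)
        · exact ⟨_, .head zs h, by simp [substNonterminals]⟩
        · obtain ⟨zs', h', rfl⟩ := (ih hz').1 h
          exact ⟨_, .tail z h', by simp [substNonterminals]⟩
      · rintro ⟨zs', h, rfl⟩
        cases h with
        | head _ h => exact Or.inl ⟨_, h, by simp [substNonterminals]⟩
        | tail _ h => exact Or.inr ⟨_, (ih hz').2 ⟨_, h, rfl⟩, by simp [substNonterminals]⟩

theorem matrixStep_substNonterminals_iff {m : MatrixRule T N} {x y : List (Symbol T N)}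
    {zs : List (List (Symbol T N))} (hz : zs.length = (nonterminalWord x).length) :
    MatrixStep m (substNonterminals zs x) y ↔
      ∃ zs', TupleStep m zs zs' ∧ y = substNonterminals zs' x := by
  induction m generalizing zs with
  | nil =>
    constructor
    · rintro ⟨⟩
      exact ⟨zs, .nil zs, rfl⟩
    · rintro ⟨_, ⟨⟩, rfl⟩
      exact .nil _
  | cons p m ih =>
    constructor
    · rintro ⟨⟩
      rename_i h₁ h₂
      obtain ⟨ys, h₃, rfl⟩ := (rewrites_substNonterminals_iff hz).1 h₁
      obtain ⟨zs', h₄, rfl⟩ := (ih (h₃.length_eq.trans hz)).1 h₂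
      exact ⟨zs', .cons h₃ h₄, rfl⟩
    · rintro ⟨zs', ⟨⟩, rfl⟩
      rename_i h₁ h₂
      exact .cons ((rewrites_substNonterminals_iff hz).2 ⟨_, h₁, rfl⟩)
        ((ih (h₁.length_eq.trans hz)).2 ⟨_, h₂, rfl⟩)

/-- The successive nonterminals of a string, as a list of one-letter strings. -/
def nonterminalTuple (x : List (Symbol T N)) : List (List (Symbol T N)) :=
  (nonterminalWord x).map fun A => [Symbol.nonterminal A]

theorem length_nonterminalTuple (x : List (Symbol T N)) :
    (nonterminalTuple x).length = (nonterminalWord x).length := by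
  simp [nonterminalTuple]

theorem length_flatten_nonterminalTuple (x : List (Symbol T N)) :
    (nonterminalTuple x).flatten.length = (nonterminalWord x).length := by
  unfold nonterminalTuple
  induction nonterminalWord x <;> simp_all

/-- A string is the substitution of its own nonterminals into itself. The admissible tuples `zs`
depend only on the nonterminal word of `x`; different tuples may still yield the same `y`. -/
theorem matrixStep_iff {m : MatrixRule T N} {x y : List (Symbol T N)} :
    MatrixStep m x y ↔
      ∃ zs, TupleStep m (nonterminalTuple x) zs ∧ y = substNonterminals zs x := by
  rw [← matrixStep_substNonterminals_iff (length_nonterminalTuple x), nonterminalTuple,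
    substNonterminals_self]

theorem MatrixStep.length_le {m : MatrixRule T N} {x y : List (Symbol T N)}
    (h : MatrixStep m x y) :
    y.length ≤ x.length + (m.map fun p => p.output.length).sum := by
  induction h with
  | nil => simp
  | cons h _ ih =>
    have := h.length_le
    simp only [List.map_cons, List.sum_cons]
    omega

/-- The Parikh vector of the terminal occurrences of a string. -/
noncomputable def terminalWeight (x : List (Symbol T N)) : T →₀ ℕ :=
  (x.map fun
    | Symbol.terminal a => Finsupp.single a 1
    | Symbol.nonterminal _ => 0).sum

theorem terminalWeight_append (x y : List (Symbol T N)) :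
    terminalWeight (x ++ y) = terminalWeight x + terminalWeight y := by
  simp [terminalWeight]

theorem terminalWeight_map_terminal (w : List T) :
    terminalWeight (w.map (Symbol.terminal (N := N))) = parikh w := by
  simp [terminalWeight, parikh, Function.comp_def]

theorem terminalWeight_substNonterminals {x : List (Symbol T N)}
    {zs : List (List (Symbol T N))} (hz : zs.length = (nonterminalWord x).length) :
    terminalWeight (substNonterminals zs x) = terminalWeight x + terminalWeight zs.flatten := by
  induction x generalizing zs with
  | nil =>
    obtain rfl : zs = [] := by simpa using hz
    simp [substNonterminals, terminalWeight]
  | cons s x ih =>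
    cases s with
    | terminal a =>
      have := ih hz
      simp only [terminalWeight, substNonterminals, List.map_cons, List.sum_cons] at this ⊢
      rw [this, add_assoc]
    | nonterminal A =>
      obtain _ | ⟨z, zs⟩ := zs
      · simp at hz
      rw [substNonterminals, terminalWeight_append, ih (by simpa using hz), List.flatten_cons,
        terminalWeight_append]
      simp only [terminalWeight, List.map_cons, List.sum_cons]
      abel

end Substitution

/-! ### Profiles of strings -/

section Profile

variable {T N : Type*}

/-- The maximal blocks of terminals of a string: the first one, and the list of the nonterminal
occurrences together with the blocks that follow them. -/
def splitGaps : List (Symbol T N) → List (Symbol T N) × List (N × List (Symbol T N))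
  | [] => ([], [])
  | Symbol.terminal a :: x => (Symbol.terminal a :: (splitGaps x).1, (splitGaps x).2)
  | Symbol.nonterminal A :: x => ([], (A, (splitGaps x).1) :: (splitGaps x).2)

/-- Strings of length at most `D`. -/
abbrev BoundedString (T N : Type*) (D : ℕ) := {p : List (Symbol T N) // p.length ≤ D}

/-- How a delay of length at most `D` between two strings develops when both are prolonged
by `w`. -/
def delays (D : ℕ) (w : List (Symbol T N)) :
    SetRel (BoundedString T N D) (BoundedString T N D) :=
  {pr | pr.1.1 ++ w = w ++ pr.2.1}

/-- The nonterminals of a string, together with the delay relations of its terminal blocks. -/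
def profile (D : ℕ) (x : List (Symbol T N)) :
    SetRel (BoundedString T N D) (BoundedString T N D) ×
      List (N × SetRel (BoundedString T N D) (BoundedString T N D)) :=
  (delays D (splitGaps x).1, (splitGaps x).2.map (Prod.map id (delays D)))

theorem delays_nil (D : ℕ) : delays D ([] : List (Symbol T N)) = SetRel.id := by
  ext ⟨p, r⟩
  simp [delays, Subtype.ext_iff]

theorem exists_append_of_append_eq {α : Type*} {p u s t : List α} (h : p ++ u ++ s = u ++ t) :
    ∃ r, p ++ u = u ++ r ∧ r.length = p.length ∧ r ++ s = t := by
  have : u <+: p ++ u := List.prefix_of_prefix_length_le (l₃ := p ++ u ++ s)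
    ⟨t, h.symm⟩ ⟨s, rfl⟩ (by simp)
  obtain ⟨r, hr⟩ := this
  refine ⟨r, hr.symm, ?_, ?_⟩
  · have := congrArg List.length hr
    simp only [List.length_append] at this
    omega
  · rw [← hr, List.append_assoc] at h
    exact List.append_cancel_left h

/-- Passing a block preserves the length of a delay, so the intermediate delay also respects the
bound `D`. -/
theorem delays_append (D : ℕ) (u w : List (Symbol T N)) :
    delays D (u ++ w) = (delays D u).comp (delays D w) := by
  ext ⟨p, r⟩
  constructor
  · intro h
    change p.1 ++ (u ++ w) = u ++ w ++ r.1 at h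
    rw [← List.append_assoc, List.append_assoc u] at h
    obtain ⟨t, h₁, h₂, h₃⟩ := exists_append_of_append_eq h
    exact ⟨⟨t, h₂.trans_le p.2⟩, h₁, h₃⟩
  · rintro ⟨t, h₁, h₂⟩
    change p.1 ++ (u ++ w) = u ++ w ++ r.1
    change p.1 ++ u = u ++ t.1 at h₁
    change t.1 ++ w = w ++ r.1 at h₂
    rw [← List.append_assoc, h₁, List.append_assoc, h₂, List.append_assoc]

/-- The profile of a concatenation as a function of the profiles of its parts. -/
def appendProfile {α : Type*} : List (N × SetRel α α) → SetRel α α →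
    SetRel α α × List (N × SetRel α α) → SetRel α α × List (N × SetRel α α)
  | [], c, P => (c.comp P.1, P.2)
  | (A, g) :: L, c, P => (c, (A, (appendProfile L g P).1) :: (appendProfile L g P).2)

/-- A relation composed on the left affects only the first block; this lets the inductions peel off
a leading terminal. -/
theorem appendProfile_comp {α : Type*} (L : List (N × SetRel α α)) (c c' : SetRel α α)
    (P : SetRel α α × List (N × SetRel α α)) :
    appendProfile L (c.comp c') P =
      (c.comp (appendProfile L c' P).1, (appendProfile L c' P).2) := by
  cases L with
  | nil => simp [appendProfile, SetRel.comp_assoc]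
  | cons s L => simp [appendProfile]

theorem profile_cons_terminal (D : ℕ) (a : T) (x : List (Symbol T N)) :
    profile D (Symbol.terminal a :: x) =
      ((delays D [Symbol.terminal a]).comp (profile D x).1, (profile D x).2) := by
  have := delays_append D [Symbol.terminal a] (splitGaps x).1
  simpa [profile, splitGaps] using this

theorem profile_append (D : ℕ) (x y : List (Symbol T N)) :
    profile D (x ++ y) = appendProfile (profile D x).2 (profile D x).1 (profile D y) := by
  induction x with
  | nil => simp [profile, splitGaps, appendProfile, delays_nil]
  | cons s x ih =>
    cases s with
    | terminal a =>
      rw [List.cons_append, profile_cons_terminal, ih, profile_cons_terminal, appendProfile_comp]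
    | nonterminal A =>
      have h (x : List (Symbol T N)) : profile D (Symbol.nonterminal A :: x) =
        (SetRel.id, (A, (profile D x).1) :: (profile D x).2) := by
        simp [profile, splitGaps, delays_nil]
      rw [List.cons_append, h, h, ih]
      rfl

theorem map_fst_profile (D : ℕ) (x : List (Symbol T N)) :
    (profile D x).2.map Prod.fst = nonterminalWord x := by
  induction x with
  | nil => rfl
  | cons s x ih => cases s <;> simp_all [profile, splitGaps]

theorem nonterminalWord_eq_of_profile_eq {D : ℕ} {x x' : List (Symbol T N)}
    (h : profile D x = profile D x') : nonterminalWord x = nonterminalWord x' := by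
  rw [← map_fst_profile D, h, map_fst_profile]

/-- Replace the nonterminal occurrences in front of the given blocks by the given strings. -/
def fillGaps : List (List (Symbol T N)) → List (N × List (Symbol T N)) → List (Symbol T N)
  | _, [] => []
  | [], (_, w) :: L => w ++ fillGaps [] L
  | z :: zs, (_, w) :: L => z ++ (w ++ fillGaps zs L)

theorem substNonterminals_eq_fillGaps (zs : List (List (Symbol T N)))
    (x : List (Symbol T N)) :
    substNonterminals zs x = (splitGaps x).1 ++ fillGaps zs (splitGaps x).2 := by
  induction x generalizing zs with
  | nil => simp [substNonterminals, splitGaps, fillGaps]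
  | cons s x ih =>
    cases s with
    | terminal a => simp [substNonterminals, splitGaps, ih]
    | nonterminal A => cases zs <;> simp [substNonterminals, splitGaps, fillGaps, ih]

/-- The profile of the result of a substitution as a function of the profile of the string. -/
def substProfile {D : ℕ} : List (List (Symbol T N)) →
    List (N × SetRel (BoundedString T N D) (BoundedString T N D)) →
    SetRel (BoundedString T N D) (BoundedString T N D) →
    SetRel (BoundedString T N D) (BoundedString T N D) ×
      List (N × SetRel (BoundedString T N D) (BoundedString T N D))
  | _, [], c => (c, [])
  | [], (_, g) :: L, c => appendProfile [] c (substProfile [] L g)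
  | z :: zs, (_, g) :: L, c =>
    appendProfile [] c (appendProfile (profile D z).2 (profile D z).1 (substProfile zs L g))

theorem substProfile_comp {D : ℕ} (zs : List (List (Symbol T N)))
    (L : List (N × SetRel (BoundedString T N D) (BoundedString T N D)))
    (c c' : SetRel (BoundedString T N D) (BoundedString T N D)) :
    substProfile zs L (c.comp c') =
      (c.comp (substProfile zs L c').1, (substProfile zs L c').2) := by
  cases L with
  | nil => simp [substProfile]
  | cons s L => cases zs <;> simp [substProfile, appendProfile, SetRel.comp_assoc]

theorem profile_substNonterminals (D : ℕ) (zs : List (List (Symbol T N)))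
    (x : List (Symbol T N)) :
    profile D (substNonterminals zs x) = substProfile zs (profile D x).2 (profile D x).1 := by
  induction x generalizing zs with
  | nil => simp [substNonterminals, profile, splitGaps, substProfile]
  | cons s x ih =>
    cases s with
    | terminal a =>
      rw [substNonterminals, profile_cons_terminal, ih, profile_cons_terminal, substProfile_comp]
    | nonterminal A =>
      have h : profile D (Symbol.nonterminal A :: x) =
        (SetRel.id, (A, (profile D x).1) :: (profile D x).2) := by
        simp [profile, splitGaps, delays_nil]
      rw [h]
      cases zs <;> simp [substNonterminals, substProfile, appendProfile, profile_append, ih]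

/-- Both sides are compared from left to right, one being ahead by `p`. A new delay is paid for by
`p` and the replacement strings just consumed, so `hD` persists and each delay is short enough to be
recorded by `delays D`. -/
theorem append_fillGaps_eq {D : ℕ} {L L' : List (N × List (Symbol T N))}
    (h : L.map (Prod.map id (delays D)) = L'.map (Prod.map id (delays D)))
    {zs zs' : List (List (Symbol T N))} (hz : zs.length = L.length) (hz' : zs'.length = L.length)
    {p : List (Symbol T N)} (hD : p.length + zs.flatten.length + zs'.flatten.length ≤ D)
    (heq : p ++ fillGaps zs L = fillGaps zs' L) :
    p ++ fillGaps zs L' = fillGaps zs' L' := by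
  induction L generalizing L' zs zs' p with
  | nil =>
    obtain rfl : L' = [] := by simpa using h
    exact heq
  | cons s L ih =>
    obtain _ | ⟨s', L'⟩ := L'
    · simp at h
    obtain _ | ⟨z, zs⟩ := zs
    · simp at hz
    obtain _ | ⟨z', zs'⟩ := zs'
    · simp at hz'
    obtain ⟨A, w⟩ := s
    obtain ⟨A', w'⟩ := s'
    simp only [List.map_cons, List.cons.injEq, Prod.map_apply, Prod.mk.injEq] at h
    obtain ⟨⟨-, hw⟩, hL⟩ := h
    simp only [List.length_cons, Nat.add_right_cancel_iff] at hz hz'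
    simp only [List.flatten_cons, List.length_append] at hD
    have transfer {s r : List (Symbol T N)} (hs : s.length ≤ D) (hr : r.length = s.length)
        (h : s ++ w = w ++ r) : s ++ w' = w' ++ r := by
      have : ((⟨s, hs⟩, ⟨r, hr.trans_le hs⟩) :
          BoundedString T N D × BoundedString T N D) ∈ delays D w := h
      rw [hw] at this
      exact this
    simp only [fillGaps] at heq ⊢
    rw [← List.append_assoc] at heq ⊢
    rcases List.append_eq_append_iff.1 heq with ⟨s, hs, h⟩ | ⟨s, hs, h⟩
    -- Here `z'` reaches at least as far as `p ++ z`, so the lead changes sides and the induction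
    -- hypothesis is used with `zs` and `zs'` exchanged.
    · have hlen := congrArg List.length hs
      simp only [List.length_append] at hlen
      rw [← List.append_assoc] at h
      obtain ⟨r, h₁, h₂, h₃⟩ := exists_append_of_append_eq h.symm
      have := ih hL hz' hz (p := r) (by omega) h₃
      rw [hs, ← this, List.append_assoc _ s, ← List.append_assoc s, transfer (by omega) h₂ h₁]
      simp
    · have hlen := congrArg List.length hs
      simp only [List.length_append] at hlen
      rw [← List.append_assoc] at h
      obtain ⟨r, h₁, h₂, h₃⟩ := exists_append_of_append_eq h.symm
      have := ih hL hz hz' (p := r) (by omega) (by simpa using h₃)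
      rw [hs, ← this, List.append_assoc _ s, ← List.append_assoc s, transfer (by omega) h₂ h₁]
      simp

/-- Whether two substitutions of bounded size give the same string depends only on the profile. -/
theorem substNonterminals_eq_of_profile_eq {D : ℕ} {x x' : List (Symbol T N)}
    (h : profile D x = profile D x') {zs zs' : List (List (Symbol T N))}
    (hz : zs.length = (nonterminalWord x).length) (hz' : zs'.length = (nonterminalWord x).length)
    (hD : zs.flatten.length + zs'.flatten.length ≤ D)
    (heq : substNonterminals zs x = substNonterminals zs' x) :
    substNonterminals zs x' = substNonterminals zs' x' := by
  rw [substNonterminals_eq_fillGaps, substNonterminals_eq_fillGaps] at heq ⊢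
  have hlen : (nonterminalWord x).length = (splitGaps x).2.length := by
    rw [← map_fst_profile D, profile]
    simp
  exact congrArg _ (append_fillGaps_eq (p := []) (congrArg Prod.snd h) (hz.trans hlen)
    (hz'.trans hlen) (by simpa using hD) (List.append_cancel_left heq))

/-- Strings with at most `k` nonterminal occurrences. -/
abbrev IndexBounded (T N : Type*) (k : ℕ) :=
  {x : List (Symbol T N) // (nonterminalWord x).length ≤ k}

theorem finite_range_profile [Finite T] [Finite N] (D k : ℕ) :
    (Set.range fun x : IndexBounded T N k => profile D x.1).Finite := by
  have := Fintype.ofFinite T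
  have := Fintype.ofFinite N
  have : Finite (BoundedString T N D) := (List.finite_length_le (Symbol T N) D).to_subtype
  have : Finite (SetRel (BoundedString T N D) (BoundedString T N D)) :=
    inferInstanceAs (Finite (Set _))
  refine (Set.finite_univ.prod (List.finite_length_le
    (N × SetRel (BoundedString T N D) (BoundedString T N D)) k)).subset ?_
  rintro _ ⟨x, rfl⟩
  refine ⟨trivial, ?_⟩
  have := x.2
  rw [← map_fst_profile D, List.length_map] at this
  exact this

end Profile

/-! ### Counting derivations of bounded index -/

namespace MatrixGrammar

variable {T N : Type*}

theorem _root_.MatrixStep.terminalWeight_le {m : MatrixRule T N} {x y : List (Symbol T N)}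
    (h : MatrixStep m x y) : terminalWeight x ≤ terminalWeight y := by
  obtain ⟨zs, hz, rfl⟩ := matrixStep_iff.1 h
  rw [terminalWeight_substNonterminals (hz.length_eq.trans (length_nonterminalTuple x))]
  exact le_self_add

theorem IsDerivation.terminalWeight_le {G : MatrixGrammar T N} {x y : List (Symbol T N)}
    {d : List (MatrixRule T N × List (Symbol T N))} (h : G.IsDerivation x d y) :
    terminalWeight x ≤ terminalWeight y := by
  induction h with
  | nil => exact le_rfl
  | cons _ h _ ih => exact h.terminalWeight_le.trans ih

theorem IsDerivation.unique {G : MatrixGrammar T N} {x y z : List (Symbol T N)}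
    {d : List (MatrixRule T N × List (Symbol T N))} (h : G.IsDerivation x d y)
    (h' : G.IsDerivation x d z) : y = z := by
  induction h with
  | nil => cases h'; rfl
  | cons _ _ _ ih =>
    cases h' with
    | cons _ _ h' => exact ih h'

/-- A bound for the total length of the strings that replace the nonterminal occurrences of a
string with at most `k` of them in one step. -/
def replacementBound (G : MatrixGrammar T N) (k : ℕ) : ℕ :=
  k + ∑ m ∈ G.rules, (m.map fun p => p.output.length).sum

theorem length_flatten_le_replacementBound (G : MatrixGrammar T N) {k : ℕ}
    {x : List (Symbol T N)} (hx : (nonterminalWord x).length ≤ k) {m : MatrixRule T N}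
    (hm : m ∈ G.rules) {zs : List (List (Symbol T N))}
    (h : TupleStep m (nonterminalTuple x) zs) : zs.flatten.length ≤ G.replacementBound k := by
  have h₁ := h.length_flatten_le
  rw [length_flatten_nonterminalTuple] at h₁
  have h₂ : (m.map fun p => p.output.length).sum ≤
      ∑ m ∈ G.rules, (m.map fun p => p.output.length).sum :=
    Finset.single_le_sum (f := fun m : MatrixRule T N => (m.map fun p => p.output.length).sum)
      (fun _ _ => Nat.zero_le _) hm
  unfold replacementBound
  omega

theorem finite_successors [Finite T] [Finite N] (G : MatrixGrammar T N) (k : ℕ)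
    (x : List (Symbol T N)) :
    {s : MatrixRule T N × List (Symbol T N) | s.1 ∈ G.rules ∧ MatrixStep s.1 x s.2 ∧
      (nonterminalWord s.2).length ≤ k}.Finite := by
  have := Fintype.ofFinite T
  have := Fintype.ofFinite N
  refine (G.rules.finite_toSet.prod (List.finite_length_le (Symbol T N)
    (x.length + ∑ m ∈ G.rules, (m.map fun p => p.output.length).sum))).subset ?_
  rintro ⟨m, y⟩ ⟨hm, h, -⟩
  refine ⟨hm, h.length_le.trans (Nat.add_le_add_left ?_ _)⟩
  exact Finset.single_le_sum
    (f := fun m : MatrixRule T N => (m.map fun p => p.output.length).sum)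
    (fun _ _ => Nat.zero_le _) hm

/-- The possible next steps from `x` that lead to a string with at most `k` nonterminal
occurrences. -/
noncomputable def successors [Finite T] [Finite N] (G : MatrixGrammar T N) (k : ℕ)
    (x : List (Symbol T N)) : Finset (MatrixRule T N × List (Symbol T N)) :=
  (G.finite_successors k x).toFinset

theorem mem_successors [Finite T] [Finite N] {G : MatrixGrammar T N} {k : ℕ}
    {x : List (Symbol T N)} {s : MatrixRule T N × List (Symbol T N)} :
    s ∈ G.successors k x ↔
      s.1 ∈ G.rules ∧ MatrixStep s.1 x s.2 ∧ (nonterminalWord s.2).length ≤ k := by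
  simp [successors]

/-- Strings with the same profile have corresponding successors. -/
theorem sum_successors_eq [Finite T] [Finite N] (G : MatrixGrammar T N) {k D : ℕ}
    (hD : 2 * G.replacementBound k ≤ D) {x x' : List (Symbol T N)}
    (hx : (nonterminalWord x).length ≤ k) (h : profile D x = profile D x')
    {M : Type*} [AddCommMonoid M]
    (g : (T →₀ ℕ) → SetRel (BoundedString T N D) (BoundedString T N D) ×
      List (N × SetRel (BoundedString T N D) (BoundedString T N D)) → M) :
    ∑ s ∈ G.successors k x, g (terminalWeight s.2 - terminalWeight x) (profile D s.2) =
      ∑ s ∈ G.successors k x', g (terminalWeight s.2 - terminalWeight x') (profile D s.2) := by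
  classical
  have hw := nonterminalWord_eq_of_profile_eq h
  have hx' : (nonterminalWord x').length ≤ k := hw ▸ hx
  have ht : nonterminalTuple x = nonterminalTuple x' := by rw [nonterminalTuple, hw]; rfl
  have hprof (zs : List (List (Symbol T N))) :
      profile D (substNonterminals zs x) = profile D (substNonterminals zs x') := by
    rw [profile_substNonterminals, profile_substNonterminals, h]
  have hcount (zs : List (List (Symbol T N))) :
      (nonterminalWord (substNonterminals zs x)).length =
        (nonterminalWord (substNonterminals zs x')).length := by
    rw [nonterminalWord_eq_of_profile_eq (hprof zs)]
  have hlen {m : MatrixRule T N} {zs : List (List (Symbol T N))}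
      (hz : TupleStep m (nonterminalTuple x) zs) : zs.length = (nonterminalWord x).length :=
    hz.length_eq.trans (length_nonterminalTuple x)
  choose! Z hZ hZx using fun s (hs : s ∈ G.successors k x) =>
    matrixStep_iff.1 (mem_successors.1 hs).2.1
  have hbound {m : MatrixRule T N} (hm : m ∈ G.rules) {zs zs' : List (List (Symbol T N))}
      (hz : TupleStep m (nonterminalTuple x) zs) (hz' : TupleStep m (nonterminalTuple x) zs') :
      zs.flatten.length + zs'.flatten.length ≤ D := by
    have h₁ := G.length_flatten_le_replacementBound hx hm hz
    have h₂ := G.length_flatten_le_replacementBound hx hm hz'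
    omega
  -- A successor of `x` is sent to the result of substituting the same tuple into `x'`. Comparing
  -- two tuples is what requires `D` to be twice `replacementBound`.
  refine Finset.sum_bij (fun s _ => (s.1, substNonterminals (Z s) x')) ?_ ?_ ?_ ?_
  · intro s hs
    obtain ⟨hm, -, hk⟩ := mem_successors.1 hs
    refine mem_successors.2 ⟨hm, matrixStep_iff.2 ⟨Z s, ht ▸ hZ s hs, rfl⟩, ?_⟩
    rw [← hcount, ← hZx s hs]
    exact hk
  · rintro ⟨m, y⟩ hs ⟨m', y'⟩ hs' heq
    simp only [Prod.mk.injEq] at heq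
    obtain ⟨rfl, heq⟩ := heq
    have h₁ := hZ _ hs
    have h₂ := hZ _ hs'
    have := substNonterminals_eq_of_profile_eq h.symm (by rw [hlen h₁, hw])
      (by rw [hlen h₂, hw]) (hbound (mem_successors.1 hs).1 h₁ h₂) heq
    rw [← hZx _ hs, ← hZx _ hs'] at this
    simpa using this
  · rintro ⟨m, y⟩ hs
    obtain ⟨hm, hstep, hk⟩ := mem_successors.1 hs
    obtain ⟨zs, hz, rfl⟩ := matrixStep_iff.1 hstep
    rw [← ht] at hz
    have hs' : (m, substNonterminals zs x) ∈ G.successors k x :=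
      mem_successors.2 ⟨hm, matrixStep_iff.2 ⟨zs, hz, rfl⟩, (hcount zs).trans_le hk⟩
    -- The chosen tuple `Z` may differ from `zs`, but both give the same string from `x`, hence also
    -- from `x'`.
    refine ⟨_, hs', Prod.ext rfl ?_⟩
    exact substNonterminals_eq_of_profile_eq h (hlen (hZ _ hs')) (hlen hz)
      (hbound hm (hZ _ hs') hz) (hZx _ hs').symm
  · intro s hs
    have h₁ := hlen (hZ s hs)
    conv_lhs => rw [hZx s hs]
    rw [hprof, terminalWeight_substNonterminals h₁,
      terminalWeight_substNonterminals (by rw [h₁, hw]), add_tsub_cancel_left,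
      add_tsub_cancel_left]

/-- The derivations with fewer than `n` steps of terminal words from `x` whose strings have at most
`k` nonterminal occurrences and which contribute the terminals `v`. -/
def boundedDerivations (G : MatrixGrammar T N) (k : ℕ) (n : ℕ∞) (x : List (Symbol T N))
    (v : T →₀ ℕ) : Set (List (MatrixRule T N × List (Symbol T N))) :=
  {d | (d.length : ℕ∞) < n ∧ (∀ s ∈ d, (nonterminalWord s.2).length ≤ k) ∧
    ∃ w : List T, G.IsDerivation x d (w.map Symbol.terminal) ∧ parikh w = terminalWeight x + v}

/-- The numbers of derivations with fewer than `n` steps and index at most `k` from `x`. -/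
noncomputable def countSeries (G : MatrixGrammar T N) (k : ℕ) (n : ℕ∞) (x : List (Symbol T N)) :
    MvPowerSeries T ℕ∞ :=
  fun v => (G.boundedDerivations k n x v).encard

theorem coeff_countSeries (G : MatrixGrammar T N) (k : ℕ) (n : ℕ∞) (x : List (Symbol T N))
    (v : T →₀ ℕ) :
    MvPowerSeries.coeff v (G.countSeries k n x) = (G.boundedDerivations k n x v).encard := rfl

theorem nil_mem_boundedDerivations {G : MatrixGrammar T N} {k : ℕ} {n : ℕ∞}
    {x : List (Symbol T N)} {v : T →₀ ℕ} :
    [] ∈ G.boundedDerivations k (n + 1) x v ↔ nonterminalWord x = [] ∧ v = 0 := by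
  constructor
  · rintro ⟨-, -, w, h, hw⟩
    generalize hy : w.map Symbol.terminal = y at h
    cases h
    subst hy
    rw [terminalWeight_map_terminal] at hw
    exact ⟨nonterminalWord_eq_nil_iff.2 ⟨w, rfl⟩, by simpa using hw⟩
  · rintro ⟨h, rfl⟩
    obtain ⟨w, rfl⟩ := nonterminalWord_eq_nil_iff.1 h
    exact ⟨by simp, by simp, w, .nil _, by simp [terminalWeight_map_terminal]⟩

/-- Terminal weights never decrease along a derivation, so the truncated subtractions are exact. -/
theorem cons_mem_boundedDerivations [Finite T] [Finite N] {G : MatrixGrammar T N} {k : ℕ} {n : ℕ∞}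
    {x : List (Symbol T N)} {v : T →₀ ℕ} {s : MatrixRule T N × List (Symbol T N)}
    {d : List (MatrixRule T N × List (Symbol T N))} :
    s :: d ∈ G.boundedDerivations k (n + 1) x v ↔ s ∈ G.successors k x ∧
      terminalWeight s.2 - terminalWeight x ≤ v ∧
      d ∈ G.boundedDerivations k n s.2 (v - (terminalWeight s.2 - terminalWeight x)) := by
  have hlen : (((s :: d).length : ℕ) : ℕ∞) < n + 1 ↔ (d.length : ℕ∞) < n := by
    push_cast [List.length_cons]
    exact ENat.add_lt_add_iff_right (by simp)
  constructor
  · rintro ⟨h₁, h₂, w, h₃, hw⟩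
    generalize hy : w.map Symbol.terminal = y at h₃
    cases h₃ with
    | cons hm hstep hd =>
      subst hy
      obtain ⟨hk, hks⟩ := List.forall_mem_cons.1 h₂
      have h₄ := hstep.terminalWeight_le
      have h₅ := hd.terminalWeight_le
      rw [terminalWeight_map_terminal, hw] at h₅
      have h₆ := tsub_le_iff_left.2 h₅
      refine ⟨mem_successors.2 ⟨hm, hstep, hk⟩, h₆, hlen.1 h₁, hks, w, hd, ?_⟩
      obtain ⟨u, hu⟩ := exists_add_of_le h₄
      simp only [hu, add_tsub_cancel_left] at h₆ ⊢
      rw [hw, add_assoc, add_tsub_cancel_of_le h₆]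
  · rintro ⟨hs, hv, h₁, h₂, w, h₃, hw⟩
    obtain ⟨hm, hstep, hk⟩ := mem_successors.1 hs
    refine ⟨hlen.2 h₁, List.forall_mem_cons.2 ⟨hk, h₂⟩, w, .cons hm hstep h₃, ?_⟩
    obtain ⟨u, hu⟩ := exists_add_of_le hstep.terminalWeight_le
    rw [hw]
    simp only [hu, add_tsub_cancel_left] at hv ⊢
    rw [add_assoc, add_tsub_cancel_of_le hv]

open Classical in
theorem countSeries_add_one [Finite T] [Finite N] (G : MatrixGrammar T N) (k : ℕ) (n : ℕ∞)
    (x : List (Symbol T N)) :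
    G.countSeries k (n + 1) x =
      ∑ s ∈ G.successors k x, MvPowerSeries.monomial (terminalWeight s.2 - terminalWeight x) 1 *
        G.countSeries k n s.2 + if nonterminalWord x = [] then 1 else 0 := by
  ext v : 1
  let C (s : MatrixRule T N × List (Symbol T N)) :
      Set (List (MatrixRule T N × List (Symbol T N))) :=
    (List.cons s) '' {d | terminalWeight s.2 - terminalWeight x ≤ v ∧
      d ∈ G.boundedDerivations k n s.2 (v - (terminalWeight s.2 - terminalWeight x))}
  let E : Set (List (MatrixRule T N × List (Symbol T N))) :=
    {d | d = [] ∧ nonterminalWord x = [] ∧ v = 0}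
  have hset : G.boundedDerivations k (n + 1) x v =
      (⋃ s ∈ (G.successors k x : Set _), C s) ∪ E := by
    ext d
    cases d with
    | nil => simp [nil_mem_boundedDerivations, C, E]
    | cons s d => simp [cons_mem_boundedDerivations, C, E, and_comm, and_left_comm]
  have hE : E.encard = MvPowerSeries.coeff v
      (if nonterminalWord x = [] then 1 else 0 : MvPowerSeries T ℕ∞) := by
    by_cases h₁ : nonterminalWord x = [] <;> by_cases h₂ : v = 0 <;>
      simp [E, h₁, h₂, MvPowerSeries.coeff_one]
  have hC (s : MatrixRule T N × List (Symbol T N)) : (C s).encard = MvPowerSeries.coeff v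
      (MvPowerSeries.monomial (terminalWeight s.2 - terminalWeight x) 1 *
        G.countSeries k n s.2) := by
    rw [MvPowerSeries.coeff_monomial_mul, List.cons_injective.encard_image]
    split_ifs with h
    · simp [h, coeff_countSeries]
    · simp [h]
  rw [coeff_countSeries, hset, Set.encard_union_eq, map_add, map_sum, hE,
    (Finset.finite_toSet _).encard_biUnion, finsum_mem_coe_finset]
  · simp only [hC]
  · intro s _ t _ hst
    refine Set.disjoint_left.2 ?_
    rintro _ ⟨d, -, rfl⟩ ⟨d', -, h⟩
    exact hst (List.cons.inj h).1.symm
  · refine Set.disjoint_left.2 fun d hd hE => ?_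
    obtain ⟨rfl, -⟩ := hE
    simp [C] at hd

/-- Any finite set of derivations has bounded length, and a cardinality in `ℕ∞` is determined by the
finite subsets. -/
theorem countSeries_top_le {G : MatrixGrammar T N} {k : ℕ} {x : List (Symbol T N)}
    {f : MvPowerSeries T ℕ∞} (h : ∀ n : ℕ, G.countSeries k n x ≤ f) :
    G.countSeries k ⊤ x ≤ f := by
  refine series_le_def.2 fun v => ?_
  rw [coeff_countSeries]
  refine ENat.forall_natCast_le_iff_le.1 fun c hc => ?_
  obtain ⟨t, ht, htc⟩ := Set.exists_subset_encard_eq hc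
  have hfin : t.Finite := Set.finite_of_encard_eq_coe htc
  obtain ⟨n, hn⟩ := (hfin.image List.length).bddAbove
  refine htc.symm.le.trans ((Set.encard_le_encard fun d hd => ?_).trans
    (series_le_def.1 (h (n + 1)) v))
  obtain ⟨-, h₂⟩ := ht hd
  refine ⟨?_, h₂⟩
  have : d.length ≤ n := hn ⟨d, hd, rfl⟩
  exact_mod_cast Nat.lt_succ_of_le this

/-- The derivations of index at most `k` from a string have a rational generating series. -/
theorem isRationalSeries_countSeries [Finite T] [Finite N] (G : MatrixGrammar T N) {k : ℕ}
    {x₀ : List (Symbol T N)} (hx₀ : (nonterminalWord x₀).length ≤ k) :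
    IsRationalSeries (G.countSeries k ⊤ x₀) := by
  classical
  set D := 2 * G.replacementBound k with hD
  let c (x : IndexBounded T N k) : Set.range fun x : IndexBounded T N k => profile D x.1 :=
    ⟨profile D x.1, x, rfl⟩
  have hc {x x' : IndexBounded T N k} : c x = c x' ↔ profile D x.1 = profile D x'.1 :=
    Subtype.ext_iff
  have : Finite (Set.range fun x : IndexBounded T N k => profile D x.1) :=
    (finite_range_profile D k).to_subtype
  have := Fintype.ofFinite (Set.range fun x : IndexBounded T N k => profile D x.1)
  have hsurj : Function.Surjective c := by
    rintro ⟨_, x, rfl⟩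
    exact ⟨x, rfl⟩
  choose r hr using hsurj
  -- The coefficients are read off a representative `r P`; by `sum_successors_eq` every other string
  -- of the class gives the same linear form.
  let A (P P' : Set.range fun x : IndexBounded T N k => profile D x.1) : MvPowerSeries T ℕ∞ :=
    ∑ s ∈ G.successors k (r P).1 with profile D s.2 = P'.1,
      MvPowerSeries.monomial (terminalWeight s.2 - terminalWeight (r P).1) 1
  let b (P : Set.range fun x : IndexBounded T N k => profile D x.1) : MvPowerSeries T ℕ∞ :=
    if nonterminalWord (r P).1 = [] then 1 else 0
  have hb (x : IndexBounded T N k) : b (c x) = if nonterminalWord x.1 = [] then 1 else 0 := by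
    simp only [b]
    rw [nonterminalWord_eq_of_profile_eq (hc.1 (hr (c x)))]
  have hA (F : (Set.range fun x : IndexBounded T N k => profile D x.1) → MvPowerSeries T ℕ∞)
      (x : IndexBounded T N k) : ∑ P, A (c x) P * F P =
        ∑ s ∈ (G.successors k x.1).attach,
          MvPowerSeries.monomial (terminalWeight s.1.2 - terminalWeight x.1) 1 *
            F (c ⟨s.1.2, (mem_successors.1 s.2).2.2⟩) := by
    -- Extension by zero to all conceivable profiles, as `sum_successors_eq` takes a function on
    -- these.
    let F' P := if h : P ∈ Set.range fun x : IndexBounded T N k => profile D x.1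
      then F ⟨P, h⟩ else 0
    have hF' P : F' P.1 = F P := dif_pos P.2
    have h₁ := G.sum_successors_eq hD.ge (r (c x)).2 (hc.1 (hr (c x)))
      fun u P => MvPowerSeries.monomial u 1 * F' P
    have h₂ (s : {s // s ∈ G.successors k x.1}) :
        F (c ⟨s.1.2, (mem_successors.1 s.2).2.2⟩) = F' (profile D s.1.2) := (hF' _).symm
    simp only [h₂]
    rw [Finset.sum_attach (G.successors k x.1) fun s =>
      MvPowerSeries.monomial (terminalWeight s.2 - terminalWeight x.1) 1 * F' (profile D s.2),
      ← h₁]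
    simp only [A, Finset.sum_mul, Finset.sum_filter]
    rw [Finset.sum_comm]
    refine Finset.sum_congr rfl fun s hs => ?_
    have hmem : profile D s.2 ∈ Set.range fun x : IndexBounded T N k => profile D x.1 :=
      ⟨⟨s.2, (mem_successors.1 hs).2.2⟩, rfl⟩
    rw [Finset.sum_eq_single ⟨_, hmem⟩]
    · rw [if_pos rfl]
      exact congrArg _ (hF' ⟨_, hmem⟩).symm
    · intro P _ hP
      rw [if_neg, zero_mul]
      exact fun h => hP (Subtype.ext h.symm)
    · simp
  have hrec (n : ℕ∞) (x : IndexBounded T N k) : G.countSeries k (n + 1) x.1 =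
      ∑ s ∈ (G.successors k x.1).attach,
        MvPowerSeries.monomial (terminalWeight s.1.2 - terminalWeight x.1) 1 *
          G.countSeries k n s.1.2 + b (c x) := by
    rw [countSeries_add_one, hb, Finset.sum_attach (G.successors k x.1) fun s =>
      MvPowerSeries.monomial (terminalWeight s.2 - terminalWeight x.1) 1 * G.countSeries k n s.2]
  obtain ⟨F, hF, hle, hmin⟩ := exists_rational_least_prefixed _ A b
    (fun P P' => .sum _ fun s _ => .monomial _ _)
    (fun P => by
      by_cases h : nonterminalWord (r P).1 = []
      · simpa [b, h] using IsRationalSeries.monomial (0 : T →₀ ℕ) 1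
      · simpa [b, h] using IsRationalSeries.monomial (0 : T →₀ ℕ) 0)
  have hupper (x : IndexBounded T N k) : G.countSeries k ⊤ x.1 ≤ F (c x) := by
    refine countSeries_top_le fun n => ?_
    induction n generalizing x with
    | zero =>
      refine series_le_def.2 fun v => ?_
      simp [coeff_countSeries, boundedDerivations]
    | succ n ih =>
      refine le_trans ?_ (hle (c x))
      rw [hA, Nat.cast_succ, hrec]
      gcongr with s
      exact ih ⟨s.1.2, _⟩
  have hlower (x : IndexBounded T N k) : F (c x) ≤ G.countSeries k ⊤ x.1 := by
    -- It is not yet known that the counting series is constant on a class, so the infimum over the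
    -- class is taken. It is a prefixed point because the recursion holds for each member.
    let H (P : Set.range fun x : IndexBounded T N k => profile D x.1) : MvPowerSeries T ℕ∞ :=
      fun v => ⨅ y : {y : IndexBounded T N k // c y = P},
        MvPowerSeries.coeff v (G.countSeries k ⊤ y.1.1)
    have hH (x : IndexBounded T N k) : H (c x) ≤ G.countSeries k ⊤ x.1 :=
      series_le_def.2 fun v =>
        iInf_le (fun y : {y : IndexBounded T N k // c y = c x} =>
          MvPowerSeries.coeff v (G.countSeries k ⊤ y.1.1)) ⟨x, rfl⟩
    refine (hmin H (fun P => series_le_def.2 fun v => le_iInf ?_) (c x)).trans (hH x)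
    rintro ⟨y, rfl⟩
    refine series_le_def.1 ?_ v
    rw [hA, show (⊤ : ℕ∞) = ⊤ + 1 by simp, hrec]
    gcongr with s
    exact hH ⟨s.1.2, _⟩
  rw [le_antisymm (hupper ⟨x₀, hx₀⟩) (hlower ⟨x₀, hx₀⟩)]
  exact hF _

end MatrixGrammar

/-! ### From counting series to characteristic series -/

theorem degree_parikh {T : Type*} (w : List T) : (parikh w).degree = w.length := by
  induction w with
  | nil => simp [parikh]
  | cons a w ih =>
    rw [parikh] at ih
    rw [parikh, List.map_cons, List.sum_cons, map_add, ih, Finsupp.degree_single,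
      List.length_cons, add_comm]

namespace MatrixGrammar

variable {T N : Type*}

theorem commImage_encard_boundedDerivations [Finite T] (G : MatrixGrammar T N) (k : ℕ) :
    commImage (fun w => {d ∈ G.derivations w |
      ∀ s ∈ d, (nonterminalWord s.2).length ≤ k}.encard) =
      G.countSeries k ⊤ [Symbol.nonterminal G.initial] := by
  ext v
  -- The Parikh vector fixes the length, so the complete sum over words is a finite sum.
  have : Finite {w : List T // parikh w = v} := by
    refine ((List.finite_length_eq T v.degree).subset ?_).to_subtype
    rintro w rfl
    exact (degree_parikh w).symm
  have := Fintype.ofFinite {w : List T // parikh w = v}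
  have hset : G.boundedDerivations k ⊤ [Symbol.nonterminal G.initial] v =
      ⋃ w : {w : List T // parikh w = v}, {d ∈ G.derivations w.1 |
        ∀ s ∈ d, (nonterminalWord s.2).length ≤ k} := by
    ext d
    simp [boundedDerivations, terminalWeight, derivations, and_comm]
  rw [coeff_countSeries, hset, Set.encard_iUnion_of_finite, finsum_eq_sum_of_fintype]
  · exact completeSum_eq_sum _
  -- A derivation determines its last string, hence the derived word.
  · refine fun w w' hne => Set.disjoint_left.2 fun d hd hd' => hne (Subtype.ext ?_)
    exact List.map_injective_iff.2 (fun _ _ h => Symbol.terminal.inj h) (hd.1.unique hd'.1)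

theorem le_derivationIndex {x : List (Symbol T N)}
    {d : List (MatrixRule T N × List (Symbol T N))} {s : MatrixRule T N × List (Symbol T N)}
    (hs : s ∈ d) : (nonterminalWord s.2).length ≤ derivationIndex x d := by
  induction d with
  | nil => simp at hs
  | cons t d ih =>
    rcases List.mem_cons.1 hs with rfl | hs
    · exact le_max_left _ _
    · exact (ih hs).trans (le_max_right _ _)

theorem IsDerivation.append {G : MatrixGrammar T N} {x y z : List (Symbol T N)}
    {d e : List (MatrixRule T N × List (Symbol T N))} (h : G.IsDerivation x d y)
    (h' : G.IsDerivation y e z) : G.IsDerivation x (d ++ e) z := by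
  induction h with
  | nil => exact h'
  | cons hm hs _ ih => exact .cons hm hs (ih h')

theorem IsDerivation.mem_sententialForms {G : MatrixGrammar T N} {x y : List (Symbol T N)}
    {d : List (MatrixRule T N × List (Symbol T N))} (h : G.IsDerivation x d y)
    (hx : x ∈ G.sententialForms) {s : MatrixRule T N × List (Symbol T N)} (hs : s ∈ d) :
    s.2 ∈ G.sententialForms := by
  induction h with
  | nil => simp at hs
  | cons hm hstep _ ih =>
    obtain ⟨e, he⟩ := hx
    have hy := he.append (.cons hm hstep (.nil _))
    rcases List.mem_cons.1 hs with rfl | hs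
    · exact ⟨_, hy⟩
    · exact ih ⟨_, hy⟩ hs

end MatrixGrammar

theorem mainTheorem4 {T N : Type*} [Finite T] [Finite N] (G : MatrixGrammar T N)
    (hfin : G.HasFiniteIndex) :
    (G.Unambiguous → IsRationalSeries (commImage (languageSeries G.language))) ∧
    (G.NormalForm → IsRationalSeries (commImage G.series)) := by
  constructor
  · intro hG
    obtain ⟨k, hk⟩ := hfin
    -- The only derivation of a word attains the minimal index, so it survives the restriction. The
    -- bound `k + 1` rather than `k` leaves room for the start symbol when `k = 0`.
    have hcount : languageSeries G.language = fun w => {d ∈ G.derivations w |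
        ∀ s ∈ d, (nonterminalWord s.2).length ≤ k + 1}.encard := by
      funext w
      by_cases hw : w ∈ G.language
      · obtain ⟨d, hd, huniq⟩ := hG w hw
        have hder : G.derivations w = {d} := Set.eq_singleton_iff_unique_mem.2 ⟨hd, huniq⟩
        have hindex := hk w hw
        rw [MatrixGrammar.wordIndex, hder, Set.image_singleton, csInf_singleton] at hindex
        have : {d ∈ G.derivations w | ∀ s ∈ d, (nonterminalWord s.2).length ≤ k + 1} = {d} := by
          rw [hder]
          refine Set.sep_eq_self_iff_mem_true.2 ?_
          rintro _ rfl s hs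
          exact (MatrixGrammar.le_derivationIndex hs).trans (hindex.trans k.le_succ)
        rw [this, Set.encard_singleton, languageSeries, if_pos hw]
      · rw [languageSeries, if_neg hw]
        refine (Set.encard_eq_zero.2 (Set.eq_empty_of_forall_notMem ?_)).symm
        exact fun d hd => hw ⟨d, hd.1⟩
    rw [hcount, MatrixGrammar.commImage_encard_boundedDerivations]
    exact G.isRationalSeries_countSeries (by simp)
  · intro hG
    have := Fintype.ofFinite N
    -- Pairwise distinct nonterminals in every sentential form bound the index of every derivation
    -- by the number of nonterminals.
    have hcount : G.series = fun w => {d ∈ G.derivations w |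
        ∀ s ∈ d, (nonterminalWord s.2).length ≤ Fintype.card N}.encard := by
      funext w
      refine congrArg Set.encard (Set.sep_eq_self_iff_mem_true.2 fun d hd s hs => ?_).symm
      exact (hG.distinct _ (MatrixGrammar.IsDerivation.mem_sententialForms hd
        ⟨[], .nil _⟩ hs)).length_le_card
    rw [hcount, MatrixGrammar.commImage_encard_boundedDerivations]
    exact G.isRationalSeries_countSeries
      (Fintype.card_pos_iff.2 ⟨G.initial⟩)
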